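/- Let $G=(V,E)$ be a finite undirected graph and $w:V\to\mathbb{R}_{>0}$. For $S\subseteq V$ write $w(S)=\sum_{x\in S}w(x)$ and $w^2(S)=\sum_{x\in S}w(x)^2$, with $w^2(u)=w(u)^2$ for a single vertex $u$, and for $U,W\subseteq V$ let $N(U,W)$ be the set of all $x\in W$ that lie in $U$ or have a neighbor in $U$; write $N(u,W)=N(\{u\},W)$. The graph $G$ is $d$-claw free if no vertex of $G$ has $d$ pairwise non-adjacent neighbors. Let $A\subseteq V$ be independent. An independent set $X\subseteq V$ is a local improvement of $w^2(A)$ if $w^2((A\setminus N(X,A))\cup X)>w^2(A)$. It is claw-shaped if $|X|=1$ and $N(X,A)=\emptyset$, or if some $v\in A$ is adjacent to all vertices of $X$. Fix a map $n$ that sends each $u\in V\setminus A$ with $N(u,A)\neq\emptyset$ to an element of $N(u,A)$ of maximum weight, and a map $n_2$ that sends each $u\in V\setminus A$ with $|N(u,A)|\ge 2$ to an element of $N(u,A)\setminus\{n(u)\}$ of maximum weight. A local improvement $X\subseteq V\setminus A$ is circular if there is $U\subseteq\{u\in X:|N(u,A)|\ge 2\}$ with $|U|\le 4\log_2|V|$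 such that (i) the multigraph $C$ with one edge $\{n(u),n_2(u)\}$ for each $u\in U$, and with the endpoints of these edges as its vertices, is a cycle, where two parallel edges form a cycle of length $2$; (ii) with $Y_v:=\{x\in X\setminus U: n(x)=v\}$ for $v\in A$, we have $|Y_v|\le d-1$ for all $v\in A$, and $X=U\cup\bigcup_{v\in V(C)}Y_v$; (iii) for each $u\in U$, with $v_1=n(u)$ and $v_2=n_2(u)$, $$w^2(u)+\tfrac12 w^2(Y_{v_1}\cup Y_{v_2})>\tfrac12\bigl(w^2(v_1)+w^2(v_2)\bigr)+w^2\bigl(N(u,A)\setminus\{v_1,v_2\}\bigr)+\tfrac12\sum_{i=1}^{2}\ \sum_{x\in Y_{v_i}}w^2\bigl(N(x,A)\setminus\{v_i\}\bigr).$$ The algorithm LogImp starts with $A=\emptyset$ and, as long as there is a claw-shaped or circular local improvement $X$ of $w^2(A)$ (with respect to maps $n,n_2$ fixed for the current set $A$), replaces $A$ by $(A\setminus N(X,A))\cup X$; when there is none, it returns $A$. **Theorem 2.** For every $\delta>0$ there is $d_\delta\in\mathbb{N}$ such that the following holds for every $d\ge d_\delta$, every finite $d$-claw free graph $G=(V,E)$,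 every $w:V\to\mathbb{R}_{>0}$ and every independent set $A^*$ of $G$ of maximum weight. If $A$ is an independent set for which there is no claw-shaped local improvement of $w^2(A)$ and, for some admissible choice of the maps $n,n_2$, no circular one, then $$w(A^*)\le\frac{d-1+\delta}{2}\cdot w(A).$$ In particular, this bound holds for every set $A$ that LogImp can return, whatever admissible maps and improvements it chooses. -/

import Mathlib

namespace MWIS

variable {V : Type*}

/-- `S` is independent (stable) in `G`. -/
def Indep (G : SimpleGraph V) (S : Finset V) : Prop :=
  ∀ x ∈ S, ∀ y ∈ S, ¬ G.Adj x y

/-- `T` is the set of talons of an induced claw of `G` with center node `v`: the vertices of `T`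
are adjacent to `v` and pairwise non-adjacent, so that `{v} ∪ T` induces a `|T|`-claw. -/
def IsClawAt (G : SimpleGraph V) (v : V) (T : Finset V) : Prop :=
  (∀ t ∈ T, G.Adj v t) ∧ Indep G T

/-- `G` has no induced `d`-claw. (For `d = 0` this says that `G` has no vertices, in accordance
with a `0`-claw being a single vertex.) -/
def ClawFree (G : SimpleGraph V) (d : ℕ) : Prop :=
  ∀ (v : V) (T : Finset V), IsClawAt G v T → T.card ≠ d

/-- The total weight `w(S)`. -/
def weight (w : V → ℝ) (S : Finset V) : ℝ := ∑ x ∈ S, w x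

/-- The total squared weight `w²(S) = ∑ x ∈ S, w(x)²`. -/
def sqWeight (w : V → ℝ) (S : Finset V) : ℝ := ∑ x ∈ S, w x ^ 2

/-- `S` is an independent set of maximum weight. -/
def IsOptimum (G : SimpleGraph V) (w : V → ℝ) (S : Finset V) : Prop :=
  Indep G S ∧ ∀ T : Finset V, Indep G T → weight w T ≤ weight w S

section Improvements

variable [DecidableEq V] (G : SimpleGraph V) [DecidableRel G.Adj] (w : V → ℝ)

/-- The neighborhood `N(U, W)`: the elements of `W` that lie in `U` or have a neighbor in `U`. -/
def nbhd (U W : Finset V) : Finset V :=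
  W.filter fun x => ∃ u ∈ U, G.Adj u x ∨ u = x

/-- The update `(A \ N(X, A)) ∪ X`. -/
def swap (A X : Finset V) : Finset V := (A \ nbhd G X A) ∪ X

/-- The set `X` is a local improvement of `w²(A)`. -/
def IsLocalImprovement (A X : Finset V) : Prop :=
  Indep G X ∧ sqWeight w A < sqWeight w (swap G A X)

/-- The local improvement `X` of `w²(A)` is claw-shaped. -/
def IsClawShaped (A X : Finset V) : Prop :=
  IsLocalImprovement G w A X ∧
    ((X.card = 1 ∧ nbhd G X A = ∅) ∨ ∃ v ∈ A, IsClawAt G v X)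

/-- `n` maps every `u ∉ A` with `N(u, A) ≠ ∅` to an element of `N(u, A)` of maximum weight.
(The other values of `n` are irrelevant.) -/
def IsHeaviestMap (A : Finset V) (n : V → V) : Prop :=
  ∀ u, u ∉ A → (nbhd G {u} A).Nonempty →
    n u ∈ nbhd G {u} A ∧ ∀ v ∈ nbhd G {u} A, w v ≤ w (n u)

/-- `n₂` maps every `u ∉ A` with `|N(u, A)| ≥ 2` to an element of `N(u, A) \ {n(u)}` of maximum
weight. (The other values of `n₂` are irrelevant.) -/
def IsSecondHeaviestMap (A : Finset V) (n n₂ : V → V) : Prop :=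
  ∀ u, u ∉ A → 2 ≤ (nbhd G {u} A).card →
    n₂ u ∈ nbhd G {u} A \ {n u} ∧ ∀ v ∈ nbhd G {u} A \ {n u}, w v ≤ w (n₂ u)

/-- The multigraph with edges `s(n u, n₂ u)`, one for each `u ∈ U`, and with the endpoints of
these edges as vertices, is a cycle of length `k + 2 ≥ 2` for some `k`: its edges can be enumerated
without repetition as `e 0, …, e (k + 1)`, such that `e i` joins `a i` and `a (i + 1)`
(indices mod `k + 2`) for pairwise distinct vertices `a 0, …, a (k + 1)`. -/
def IsCycle (n n₂ : V → V) (U : Finset V) : Prop :=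
  ∃ (k : ℕ) (a e : Fin (k + 2) → V), Function.Injective a ∧ Function.Injective e ∧
    Finset.univ.image e = U ∧ ∀ i, s(n (e i), n₂ (e i)) = s(a i, a (i + 1))

/-- The set `Y_v` of all `x ∈ X \ U` for which `n(x)` is defined and equal to `v`. -/
def attached (A : Finset V) (n : V → V) (X U : Finset V) (v : V) : Finset V :=
  (X \ U).filter fun x => (nbhd G {x} A).Nonempty ∧ n x = v

/-- The local improvement `X` of `w²(A)` is circular with respect to the maps `n` and `n₂`. -/
def IsCircular [Fintype V] (d : ℕ) (A : Finset V) (n n₂ : V → V) (X : Finset V) : Prop :=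
  IsLocalImprovement G w A X ∧ Disjoint X A ∧
  ∃ U ⊆ X, (∀ u ∈ U, 2 ≤ (nbhd G {u} A).card) ∧
    (U.card : ℝ) ≤ 4 * Real.logb 2 (Fintype.card V) ∧
    IsCycle n n₂ U ∧
    (∀ v ∈ A, ((attached G A n X U v).card : ℤ) ≤ (d : ℤ) - 1) ∧
    X = U ∪ (U.biUnion fun u => {n u, n₂ u}).biUnion (attached G A n X U) ∧
    ∀ u ∈ U,
      (w (n u) ^ 2 + w (n₂ u) ^ 2) / 2 + sqWeight w (nbhd G {u} A \ {n u, n₂ u})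
        + (1 / 2) * ∑ x ∈ attached G A n X U (n u), sqWeight w (nbhd G {x} A \ {n u})
        + (1 / 2) * ∑ x ∈ attached G A n X U (n₂ u), sqWeight w (nbhd G {x} A \ {n₂ u})
      < w u ^ 2
        + (1 / 2) * sqWeight w (attached G A n X U (n u) ∪ attached G A n X U (n₂ u))

/-- There is neither a claw-shaped nor a circular local improvement of `w²(A)`. -/
def IsLocallyOptimal [Fintype V] (d : ℕ) (A : Finset V) (n n₂ : V → V) : Prop :=
  ∀ X : Finset V, ¬ IsClawShaped G w A X ∧ ¬ IsCircular G w d A n n₂ X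

/-- `n A` and `n₂ A` are admissible choices of the two maps for every independent set `A`. -/
def IsMapChoice (n n₂ : Finset V → V → V) : Prop :=
  ∀ A, Indep G A → IsHeaviestMap G w A (n A) ∧ IsSecondHeaviestMap G w A (n A) (n₂ A)

/-- One iteration of the algorithm LogImp leads from `A` to `B`. -/
def LogImpStep [Fintype V] (d : ℕ) (n n₂ : Finset V → V → V) (A B : Finset V) : Prop :=
  ∃ X, (IsClawShaped G w A X ∨ IsCircular G w d A (n A) (n₂ A) X) ∧ B = swap G A X

/-- Some run of LogImp, started with the empty set, stops and returns `A`. -/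
def LogImpReturns [Fintype V] (d : ℕ) (n n₂ : Finset V → V → V) (A : Finset V) : Prop :=
  Relation.ReflTransGen (LogImpStep G w d n n₂) ∅ A ∧ ∀ B, ¬ LogImpStep G w d n n₂ A B

end Improvements

end MWIS

/-! Let `O` be the optimum outside of `A`, and `S` the part of `A` outside of the optimum. Let `n u`
be the heaviest neighbor of `u ∈ O` in `A`, and call w²(u) - w²(N(u,A) \ {n u}) its gain. Expanding
(w(u) - w(n u))² ≥ 0 shows that w(u) exceeds w(N(u,A))/2 by at most gain/(2w(n u)). As no
claw-shaped improvement exists, the positive gains at `v ∈ S` sum to at most w(v)² (`sum_gain_le`).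
As `v` has at most D = d - 1 neighbors in `O`, summation yields w(O) ≤ (D + 1)/2 · w(S). The extra
1/2 · w(S) must be brought down to δ/2 · w(S).

Call `v` tight if its total gain is at least 16η w(v)², and let `B` be the set of tight vertices in
`S`. If w(B) ≤ 16η w(S), the gains contribute little. Otherwise it suffices that vertices of `O` see
little of `B`: the sum of w(N(u,A)) then falls short of D w(S) by nearly D w(B), which outweighs
everything else for large D.

By `gain_or_isNear`, each `u` falls well short of w(N(u,A))/2, or has substantial gain, or is near:
it weighs about as much as `n u` and `n₂ u`, and its other neighbors in `A` are light. The first two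
kinds are paid for by total deficit and total gain, and near vertices without a tight heavy neighbor
see almost nothing of `B`. The remaining near vertices are edges {n u, n₂ u} of a multigraph on `S`.
A logarithmically short cycle in it would be a circular improvement, the gains at tight vertices
providing the slack (`IsNear.local_condition`, `isCircular_of_isCycle`). Without short cycles the
multigraph is 2-degenerate by a Moore bound, so these vertices weigh at most 4w(S) (`sum_near_le`).
`sum_le_of_gain_bounds` combines the estimates. -/

namespace SimpleGraph

/-! ### Short cycles in simple graphs of minimum degree three. -/

variable {V : Type*}

/-- Two distinct paths with the same ends yield a cycle that is at most as long as both together. -/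
theorem exists_isCycle_length_le_of_isPath_ne {H : SimpleGraph V} {u v : V} {p q : H.Walk u v}
    (hp : p.IsPath) (hq : q.IsPath) (hne : p ≠ q) :
    ∃ x, ∃ c : H.Walk x x, c.IsCycle ∧ c.length ≤ p.length + q.length := by
  classical
  -- In a forest paths are unique, so the union of the two paths contains a cycle; its edges are
  -- distinct and all lie on `p` or `q`.
  set K : SimpleGraph V := fromEdgeSet {e | e ∈ p.edges ∨ e ∈ q.edges} with hK
  have hpK : ∀ e ∈ p.edges, e ∈ K.edgeSet := fun e he => by
    rw [hK, edgeSet_fromEdgeSet]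
    exact ⟨Or.inl he, H.not_isDiag_of_mem_edgeSet (p.edges_subset_edgeSet he)⟩
  have hqK : ∀ e ∈ q.edges, e ∈ K.edgeSet := fun e he => by
    rw [hK, edgeSet_fromEdgeSet]
    exact ⟨Or.inr he, H.not_isDiag_of_mem_edgeSet (q.edges_subset_edgeSet he)⟩
  have hKsub : ∀ e ∈ K.edgeSet, e ∈ p.edges ∨ e ∈ q.edges := fun e he => by
    rw [hK, edgeSet_fromEdgeSet] at he
    exact he.1
  have hcyc : ¬ K.IsAcyclic := by
    intro hac
    have h1 := (hac.subsingleton_path u v).elim ⟨_, hp.transfer hpK⟩ ⟨_, hq.transfer hqK⟩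
    apply hne
    apply Walk.ext_support
    have := congrArg (fun r : K.Path u v => r.1.support) h1
    simpa using this
  simp only [IsAcyclic, not_forall, not_not] at hcyc
  obtain ⟨x, c, hc⟩ := hcyc
  have hcH : ∀ e ∈ c.edges, e ∈ H.edgeSet := fun e he =>
    (hKsub e (c.edges_subset_edgeSet he)).elim (fun h => p.edges_subset_edgeSet h)
      (fun h => q.edges_subset_edgeSet h)
  refine ⟨x, c.transfer H hcH, hc.transfer hcH, ?_⟩
  rw [Walk.length_transfer]
  have hsub : c.edges ⊆ p.edges ++ q.edges := fun e he =>
    List.mem_append.2 (hKsub e (c.edges_subset_edgeSet he))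
  have := (hc.edges_nodup.subperm hsub).length_le
  simpa using this

/-- A weak form of the Moore bound: a graph of minimum degree at least three has a cycle of
logarithmic length. -/
theorem exists_isCycle_length_le_of_three_le_degree {H : SimpleGraph V} {S : Finset V}
    (hS : S.Nonempty) (hdeg : ∀ v ∈ S, ∃ T ⊆ S, (∀ y ∈ T, H.Adj v y) ∧ 3 ≤ T.card)
    {k : ℕ} (hk : S.card < 2 ^ k) :
    ∃ x, ∃ c : H.Walk x x, c.IsCycle ∧ c.length ≤ 2 * k := by
  classical
  by_contra hno
  push Not at hno
  have huniq : ∀ {u v : V} {p q : H.Walk u v}, p.IsPath → q.IsPath → p.length ≤ k →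
      q.length ≤ k → p = q := by
    intro u v p q hp hq hpk hqk
    by_contra hne
    obtain ⟨x, c, hc, hl⟩ := exists_isCycle_length_le_of_isPath_ne hp hq hne
    have := hno x c hc
    omega
  obtain ⟨r, hr⟩ := hS
  -- Paths of length at most `k` are determined by their ends, so these spheres around `r` at least
  -- double in size up to radius `k`, which forces `2 ^ k ≤ S.card`.
  set sph : ℕ → Finset V := fun j => S.filter fun v => ∃ p : H.Walk r v, p.IsPath ∧ p.length = j
    with hsph
  have hgrow : ∀ j, j + 1 ≤ k → (sph j).card * 2 ≤ (sph (j + 1)).card * 1 := by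
    intro j hj
    refine Finset.card_mul_le_card_mul
      (fun v y => ∃ (p : H.Walk r v) (h : H.Adj v y), (p.concat h).IsPath ∧ p.length = j) ?_ ?_
    · intro v hv
      obtain ⟨hvS, p, hp, hpl⟩ := Finset.mem_filter.1 hv
      obtain ⟨T, hTS, hT, hT3⟩ := hdeg v hvS
      have hsub : T.erase p.penultimate ⊆ Finset.bipartiteAbove
          (fun v y => ∃ (p : H.Walk r v) (h : H.Adj v y), (p.concat h).IsPath ∧ p.length = j)
          (sph (j + 1)) v := by
        intro y hy
        obtain ⟨hyne, hyT⟩ := Finset.mem_erase.1 hy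
        have hadj := hT y hyT
        have hnot : y ∉ p.support := by
          intro hyp
          -- A neighbor `y` of `v` on `p` is joined to `v` by the tail of `p` and by a single edge;
          -- by uniqueness these agree, so `y` is the penultimate vertex.
          have h1 : p.dropUntil y hyp = hadj.symm.toWalk :=
            huniq (hp.dropUntil hyp) (by simpa using hadj.symm.ne)
              ((p.length_dropUntil_le_length hyp).trans (by omega)) (by simp; omega)
          apply hyne
          apply hp.eq_penultimate_of_mem_edges
          apply p.edges_dropUntil_subset_edges hyp
          rw [h1]
          simp [Sym2.eq_swap]
        have hpc := hp.concat hnot hadj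
        rw [Finset.mem_bipartiteAbove]
        refine ⟨Finset.mem_filter.2 ⟨hTS hyT, p.concat hadj, hpc, by simp [hpl]⟩,
          p, hadj, hpc, hpl⟩
      refine le_trans ?_ (Finset.card_le_card hsub)
      have := Finset.pred_card_le_card_erase (s := T) (a := p.penultimate)
      omega
    · intro y _
      rw [Finset.card_le_one]
      intro v hv v' hv'
      rw [Finset.mem_bipartiteBelow] at hv hv'
      obtain ⟨-, p, h, hp, hpl⟩ := hv
      obtain ⟨-, p', h', hp', hpl'⟩ := hv'
      exact (Walk.concat_inj (huniq hp hp' (by simp; omega) (by simp; omega))).1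
  have hpow : ∀ j, j ≤ k → 2 ^ j ≤ (sph j).card := by
    intro j
    induction j with
    | zero =>
      intro _
      rw [pow_zero, Nat.one_le_iff_ne_zero, Finset.card_ne_zero]
      exact ⟨r, Finset.mem_filter.2 ⟨hr, Walk.nil, by simp, by simp⟩⟩
    | succ j ih =>
      intro hj
      have := hgrow j hj
      have := ih (by omega)
      rw [pow_succ]
      omega
  have := hpow k le_rfl
  have := Finset.card_le_card (Finset.filter_subset
    (fun v => ∃ p : H.Walk r v, p.IsPath ∧ p.length = k) S)
  simp only [hsph] at *
  omega

end SimpleGraph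

/-! ### Short cycles in the multigraph with edges {n u, n₂ u}, and the weight of its edges. -/

namespace MWIS

variable {V : Type*} [DecidableEq V]

/-- Double counting the vertices of a cycle by its edges. -/
theorem IsCycle.sum_eq {n n₂ : V → V} {U : Finset V} (h : IsCycle n n₂ U) (F : V → ℝ) :
    ∑ u ∈ U, (F (n u) + F (n₂ u)) = 2 * ∑ v ∈ U.biUnion (fun u => {n u, n₂ u}), F v := by
  obtain ⟨k, a, e, ha, he, rfl, hae⟩ := h
  have hends : ∀ (H : V → ℝ) i, H (n (e i)) + H (n₂ (e i)) = H (a i) + H (a (i + 1)) := by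
    intro H i
    rcases Sym2.eq_iff.1 (hae i) with ⟨h1, h2⟩ | ⟨h1, h2⟩ <;> rw [h1, h2]
    ring
  have hV : (Finset.univ.image e).biUnion (fun u => {n u, n₂ u}) = Finset.univ.image a := by
    ext v
    simp only [Finset.mem_biUnion, Finset.mem_image, Finset.mem_univ, true_and,
      exists_exists_eq_and, Finset.mem_insert, Finset.mem_singleton]
    constructor
    · rintro ⟨i, hi⟩
      rcases Sym2.eq_iff.1 (hae i) with ⟨h1, h2⟩ | ⟨h1, h2⟩ <;> rw [h1, h2] at hi <;>
        rcases hi with rfl | rfl <;> exact ⟨_, rfl⟩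
    · rintro ⟨i, rfl⟩
      refine ⟨i, ?_⟩
      rcases Sym2.eq_iff.1 (hae i) with ⟨h1, h2⟩ | ⟨h1, h2⟩
      · exact Or.inl h1.symm
      · exact Or.inr h2.symm
  rw [hV, Finset.sum_image he.injOn, Finset.sum_image ha.injOn]
  simp_rw [hends F]
  rw [Finset.sum_add_distrib, two_mul]
  congr 1
  -- Each vertex `a i` ends the two edges `e i` and `e (i - 1)`; the cyclic shift makes both sums
  -- equal.
  exact Equiv.sum_comp (Equiv.addRight (1 : Fin (k + 2))) (fun i => F (a i))

/-- A multigraph of minimum degree at least three contains a cycle of logarithmic length. -/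
theorem exists_isCycle_of_three_le_degree {n n₂ : V → V} {E S : Finset V} (hS : S.Nonempty)
    (hE : ∀ u ∈ E, n u ∈ S ∧ n₂ u ∈ S ∧ n u ≠ n₂ u)
    (hdeg : ∀ v ∈ S, 3 ≤ (E.filter fun u => n u = v ∨ n₂ u = v).card)
    {k : ℕ} (hk : S.card < 2 ^ k) :
    ∃ U ⊆ E, IsCycle n n₂ U ∧ U.card ≤ 2 * k := by
  classical
  -- Two parallel edges already form a cycle of length 2, which must not exceed `2 * k`.
  have hk1 : 1 ≤ k := by
    rcases Nat.eq_zero_or_pos k with rfl | h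
    · have := hS.card_pos
      rw [pow_zero] at hk
      omega
    · exact h
  by_cases hpar : ∃ u ∈ E, ∃ u' ∈ E, u ≠ u' ∧ s(n u, n₂ u) = s(n u', n₂ u')
  · obtain ⟨u, hu, u', hu', hne, hs⟩ := hpar
    refine ⟨{u, u'}, ?_, ⟨0, ![n u, n₂ u], ![u, u'], ?_, ?_, ?_, ?_⟩, ?_⟩
    · intro x hx
      simp only [Finset.mem_insert, Finset.mem_singleton] at hx
      rcases hx with rfl | rfl <;> assumption
    · have := (hE u hu).2.2
      intro i j hij
      fin_cases i <;> fin_cases j <;>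
        first | rfl | exact absurd hij this | exact absurd hij.symm this
    · intro i j hij
      fin_cases i <;> fin_cases j <;> simp_all
    · ext x
      simp [eq_comm]
    · intro i
      fin_cases i
      · simp
      · simpa [Sym2.eq_swap] using hs.symm
    · rw [Finset.card_pair hne]
      omega
  · push Not at hpar
    set H : SimpleGraph V := SimpleGraph.fromRel
      (fun x y => ∃ u ∈ E, s(n u, n₂ u) = s(x, y)) with hH
    have hadj : ∀ {x y}, H.Adj x y ↔ ∃ u ∈ E, s(n u, n₂ u) = s(x, y) := by
      intro x y
      rw [hH, SimpleGraph.fromRel_adj]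
      constructor
      · rintro ⟨-, h | ⟨u, hu, h⟩⟩
        · exact h
        · exact ⟨u, hu, h.trans Sym2.eq_swap⟩
      · rintro ⟨u, hu, h⟩
        refine ⟨?_, Or.inl ⟨u, hu, h⟩⟩
        rintro rfl
        have := (hE u hu).2.2
        rcases Sym2.eq_iff.1 h with ⟨h1, h2⟩ | ⟨h1, h2⟩ <;> exact this (h1.trans h2.symm)
    obtain ⟨x, c, hc, hcl⟩ := SimpleGraph.exists_isCycle_length_le_of_three_le_degree
      -- Without parallel edges, distinct edges at `v` lead to distinct neighbors, so the degree
      -- bound passes to `H`.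
      (H := H) hS (fun v hv => by
        refine ⟨(E.filter fun u => n u = v ∨ n₂ u = v).image
          (fun u => if n u = v then n₂ u else n u), ?_, ?_, ?_⟩
        · intro y hy
          obtain ⟨u, hu, rfl⟩ := Finset.mem_image.1 hy
          have := hE u (Finset.mem_filter.1 hu).1
          split_ifs
          · exact this.2.1
          · exact this.1
        · intro y hy
          obtain ⟨u, hu, rfl⟩ := Finset.mem_image.1 hy
          obtain ⟨huE, huv⟩ := Finset.mem_filter.1 hu
          refine hadj.2 ⟨u, huE, ?_⟩
          split_ifs with h
          · rw [h]
          · rw [huv.resolve_left h, Sym2.eq_swap]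
        · rw [Finset.card_image_of_injOn]
          · exact hdeg v hv
          · intro u hu u' hu' huu
            have hu := Finset.mem_filter.1 (Finset.mem_coe.1 hu)
            have hu' := Finset.mem_filter.1 (Finset.mem_coe.1 hu')
            by_contra hne
            apply hpar u hu.1 u' hu'.1 hne
            dsimp only at huu
            have h1 : ∀ u, (n u = v ∨ n₂ u = v) →
                s(n u, n₂ u) = s(v, if n u = v then n₂ u else n u) := by
              intro u hu
              split_ifs with h
              · rw [h]
              · rw [hu.resolve_left h, Sym2.eq_swap]
            rw [h1 u hu.2, h1 u' hu'.2, huu]) hk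
    have h3 := hc.three_le_length
    obtain ⟨m, hm⟩ : ∃ m, c.length = m + 2 := ⟨c.length - 2, by omega⟩
    -- At the last index, `i + 1` wraps around to 0, which is harmless since the closed walk ends
    -- where it starts.
    have hstep : ∀ i : Fin (m + 2), c.getVert (i + 1 : Fin (m + 2)).1 = c.getVert (i.1 + 1) := by
      intro i
      by_cases hi : i = Fin.last (m + 1)
      · subst hi
        rw [Fin.last_add_one]
        simp only [Fin.val_zero, Fin.val_last, SimpleGraph.Walk.getVert_zero]
        rw [show m + 1 + 1 = c.length by omega, SimpleGraph.Walk.getVert_length]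
      · rw [Fin.val_add_one_of_lt (Fin.lt_last_iff_ne_last.2 hi)]
    have hinj : Function.Injective (fun i : Fin (m + 2) => c.getVert i.1) := by
      intro i j hij
      apply Fin.ext
      exact hc.getVert_injOn' (by simp only [Set.mem_ofPred_eq]; omega)
        (by simp only [Set.mem_ofPred_eq]; omega) hij
    have hedge : ∀ i : Fin (m + 2), ∃ u ∈ E,
        s(n u, n₂ u) = s(c.getVert i.1, c.getVert (i.1 + 1)) := fun i =>
      hadj.1 (c.adj_getVert_succ (by omega))
    choose e heE he using hedge
    have heinj : Function.Injective e := by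
      intro i j hij
      have h1 := (he i).symm.trans ((congrArg (fun u => s(n u, n₂ u)) hij).trans (he j))
      have hi : i.1 < c.edges.length := by rw [SimpleGraph.Walk.length_edges]; omega
      have hj : j.1 < c.edges.length := by rw [SimpleGraph.Walk.length_edges]; omega
      have h2 : c.edges[i.1] = c.edges[j.1] := by
        rw [SimpleGraph.Walk.getElem_edges, SimpleGraph.Walk.getElem_edges]
        exact h1
      exact Fin.ext ((hc.edges_nodup.getElem_inj_iff).1 h2)
    refine ⟨Finset.univ.image e, ?_, ⟨m, fun i => c.getVert i.1, e, hinj, heinj, rfl, ?_⟩, ?_⟩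
    · intro u hu
      obtain ⟨i, -, rfl⟩ := Finset.mem_image.1 hu
      exact heE i
    · intro i
      rw [he i, ← hstep i]
    · refine Finset.card_image_le.trans ?_
      simp only [Finset.card_univ, Fintype.card_fin]
      omega

/-- Without short cycles, a multigraph whose edges weigh at most twice their ends is light. -/
theorem sum_le_of_forall_not_isCycle {n n₂ : V → V} {w : V → ℝ} {E : Finset V} {k : ℕ}
    (hwE : ∀ u ∈ E, n u ≠ n₂ u ∧ w u ≤ 2 * w (n u) ∧ w u ≤ 2 * w (n₂ u))
    (hcyc : ∀ U ⊆ E, IsCycle n n₂ U → ¬ U.card ≤ 2 * k) (S : Finset V) (hw : ∀ v ∈ S, 0 ≤ w v)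
    (hk : S.card < 2 ^ k) :
    ∑ u ∈ E.filter (fun u => n u ∈ S ∧ n₂ u ∈ S), w u ≤ 4 * ∑ v ∈ S, w v := by
  induction S using Finset.strongInduction with
  | H S ih =>
    by_cases hS : S.Nonempty
    · have hlow : ∃ v ∈ S, ((E.filter (fun u => n u ∈ S ∧ n₂ u ∈ S)).filter
          fun u => n u = v ∨ n₂ u = v).card ≤ 2 := by
        by_contra hno
        push Not at hno
        obtain ⟨U, hU, hUc, hUk⟩ := exists_isCycle_of_three_le_degree
          (n := n) (n₂ := n₂) (E := E.filter (fun u => n u ∈ S ∧ n₂ u ∈ S)) hS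
          (fun u hu => by
            have := Finset.mem_filter.1 hu
            exact ⟨this.2.1, this.2.2, (hwE u this.1).1⟩)
          (fun v hv => hno v hv) hk
        exact hcyc U (hU.trans (Finset.filter_subset _ _)) hUc hUk
      obtain ⟨v, hv, hdeg⟩ := hlow
      have ih' := ih (S.erase v) (Finset.erase_ssubset hv)
        (fun x hx => hw x (Finset.mem_of_mem_erase hx))
        (lt_of_le_of_lt (Finset.card_le_card (Finset.erase_subset _ _)) hk)
      rw [← Finset.sum_filter_add_sum_filter_not _ (fun u => n u = v ∨ n₂ u = v),
        ← Finset.add_sum_erase S w hv]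
      have h1 : (E.filter (fun u => n u ∈ S ∧ n₂ u ∈ S)).filter (fun u => ¬ (n u = v ∨ n₂ u = v))
          = E.filter (fun u => n u ∈ S.erase v ∧ n₂ u ∈ S.erase v) := by
        ext u
        simp only [Finset.mem_filter, Finset.mem_erase]
        tauto
      rw [h1]
      have h2 := Finset.sum_le_card_nsmul ((E.filter (fun u => n u ∈ S ∧ n₂ u ∈ S)).filter
          fun u => n u = v ∨ n₂ u = v) w (2 * w v) (by
        intro u hu
        obtain ⟨hu, h⟩ := Finset.mem_filter.1 hu
        have := hwE u (Finset.mem_filter.1 hu).1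
        rcases h with rfl | rfl
        · exact this.2.1
        · exact this.2.2)
      rw [nsmul_eq_mul] at h2
      have h3 : (((E.filter (fun u => n u ∈ S ∧ n₂ u ∈ S)).filter
          fun u => n u = v ∨ n₂ u = v).card : ℝ) ≤ 2 := by exact_mod_cast hdeg
      have h4 := mul_le_mul_of_nonneg_right h3 (by linarith [hw v hv] : 0 ≤ 2 * w v)
      linarith
    · rw [Finset.not_nonempty_iff_eq_empty.1 hS]
      simp

end MWIS

/-! ### Gains, and what the absence of improvements says about them. -/

namespace MWIS

variable {V : Type*}

theorem Indep.mono {G : SimpleGraph V} {S T : Finset V} (hT : Indep G T) (h : S ⊆ T) :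
    Indep G S :=
  fun x hx y hy => hT x (h hx) y (h hy)

section Sums

variable {w : V → ℝ}

theorem sqWeight_nonneg (S : Finset V) : 0 ≤ sqWeight w S :=
  Finset.sum_nonneg fun _ _ => sq_nonneg _

theorem sqWeight_mono {S T : Finset V} (h : S ⊆ T) : sqWeight w S ≤ sqWeight w T :=
  Finset.sum_le_sum_of_subset_of_nonneg h fun _ _ _ => sq_nonneg _

variable [DecidableEq V]

theorem sqWeight_union_le (S T : Finset V) :
    sqWeight w (S ∪ T) ≤ sqWeight w S + sqWeight w T := by
  have := Finset.sum_union_inter (s₁ := S) (s₂ := T) (f := fun x => w x ^ 2)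
  have := sqWeight_nonneg (w := w) (S ∩ T)
  unfold sqWeight at *
  linarith

theorem sqWeight_biUnion_le {ι : Type*} [DecidableEq ι] (I : Finset ι) (f : ι → Finset V) :
    sqWeight w (I.biUnion f) ≤ ∑ i ∈ I, sqWeight w (f i) := by
  induction I using Finset.induction_on with
  | empty => simp [sqWeight]
  | insert i I hi ih =>
    rw [Finset.biUnion_insert, Finset.sum_insert hi]
    exact (sqWeight_union_le _ _).trans (by linarith)

end Sums

variable [DecidableEq V] {G : SimpleGraph V} [DecidableRel G.Adj] {w : V → ℝ} {A : Finset V} {n n₂ : V → V}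

theorem mem_nbhd {U W : Finset V} {x : V} :
    x ∈ nbhd G U W ↔ x ∈ W ∧ ∃ u ∈ U, G.Adj u x ∨ u = x := by
  simp [nbhd]

theorem mem_nbhd_singleton {u x : V} (hu : u ∉ A) :
    x ∈ nbhd G {u} A ↔ x ∈ A ∧ G.Adj u x := by
  rw [mem_nbhd]
  constructor
  · rintro ⟨hx, y, hy, h⟩
    rw [Finset.mem_singleton] at hy
    subst hy
    refine ⟨hx, h.resolve_right ?_⟩
    rintro rfl
    exact hu hx
  · rintro ⟨hx, h⟩
    exact ⟨hx, u, by simp, Or.inl h⟩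

theorem nbhd_eq_biUnion {X : Finset V} : nbhd G X A = X.biUnion fun u => nbhd G {u} A := by
  ext x
  simp only [mem_nbhd, Finset.mem_biUnion, Finset.mem_singleton, exists_eq_left]
  exact ⟨fun ⟨hx, u, hu, h⟩ => ⟨u, hu, hx, h⟩, fun ⟨u, hu, hx, h⟩ => ⟨hx, u, hu, h⟩⟩

/-- The gain `w²(u) - w²(N(u, A) \ {n(u)})` of `u`. -/
noncomputable def gain (G : SimpleGraph V) [DecidableRel G.Adj] (w : V → ℝ) (A : Finset V) (n : V → V)
    (u : V) : ℝ :=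
  w u ^ 2 - sqWeight w (nbhd G {u} A \ {n u})

theorem isLocalImprovement_of_lt {X : Finset V} (hX : Indep G X) (hXA : Disjoint X A)
    (h : sqWeight w (nbhd G X A) < sqWeight w X) : IsLocalImprovement G w A X := by
  refine ⟨hX, ?_⟩
  have h1 : Disjoint (A \ nbhd G X A) X := (hXA.mono_right Finset.sdiff_subset).symm
  have h2 : nbhd G X A ⊆ A := Finset.filter_subset _ _
  have h3 := Finset.sum_sdiff (f := fun x => w x ^ 2) h2
  unfold swap
  unfold sqWeight at *
  rw [Finset.sum_union h1]
  linarith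

theorem nbhd_nonempty_of_not_isClawShaped (hclaw : ∀ X, ¬ IsClawShaped G w A X) {u : V}
    (hw : 0 < w u) (hu : u ∉ A) : (nbhd G {u} A).Nonempty := by
  by_contra hne
  rw [Finset.not_nonempty_iff_eq_empty] at hne
  refine hclaw {u} ⟨isLocalImprovement_of_lt ?_ (by simpa using hu) ?_, Or.inl ⟨by simp, hne⟩⟩
  · intro x hx y hy
    rw [Finset.mem_singleton] at hx hy
    subst hx hy
    exact G.irrefl
  · rw [hne]
    simp only [sqWeight, Finset.sum_empty, Finset.sum_singleton]
    positivity

/-- If there is no claw-shaped improvement, the total gain at `v` is at most `w²(v)`. -/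
theorem sum_gain_le (hclaw : ∀ X, ¬ IsClawShaped G w A X) {T : Finset V} (hT : Indep G T)
    (hTA : Disjoint T A) {v : V} (hv : v ∈ A)
    (hn : ∀ u ∈ T, n u = v ∧ v ∈ nbhd G {u} A) : ∑ u ∈ T, gain G w A n u ≤ w v ^ 2 := by
  by_contra hlt
  push Not at hlt
  refine hclaw T ⟨isLocalImprovement_of_lt hT hTA ?_, Or.inr ⟨v, hv, ?_, hT⟩⟩
  -- All of `T` shares the neighbor `v`, so w²(v) is paid once; gains exceeding it would make `T` an
  -- improvement.
  · have hsub : nbhd G T A ⊆ {v} ∪ T.biUnion fun u => nbhd G {u} A \ {n u} := by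
      rw [nbhd_eq_biUnion]
      intro x hx
      obtain ⟨u, hu, hxu⟩ := Finset.mem_biUnion.1 hx
      by_cases hxv : x = v
      · exact Finset.mem_union_left _ (by simpa using hxv)
      · refine Finset.mem_union_right _ (Finset.mem_biUnion.2 ⟨u, hu, ?_⟩)
        rw [(hn u hu).1]
        exact Finset.mem_sdiff.2 ⟨hxu, by simpa using hxv⟩
    have h1 := (sqWeight_mono (w := w) hsub).trans (sqWeight_union_le _ _)
    have h2 := sqWeight_biUnion_le (w := w) T fun u => nbhd G {u} A \ {n u}
    have h3 : sqWeight w {v} = w v ^ 2 := by simp [sqWeight]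
    simp only [gain, Finset.sum_sub_distrib] at hlt
    unfold sqWeight at *
    linarith
  · intro t ht
    exact ((mem_nbhd_singleton (Finset.disjoint_left.1 hTA ht)).1 (hn t ht).2).2.symm

/-- The elements of `O` with heaviest neighbor `v` and positive gain. -/
noncomputable def gainers (G : SimpleGraph V) [DecidableRel G.Adj] (w : V → ℝ) (A O : Finset V) (n : V → V)
    (v : V) : Finset V :=
  open Classical in O.filter fun x => n x = v ∧ 0 < gain G w A n x

theorem mem_gainers {O : Finset V} {v x : V} :
    x ∈ gainers G w A O n v ↔ x ∈ O ∧ n x = v ∧ 0 < gain G w A n x := by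
  simp [gainers]

/-- A short cycle whose edges satisfy the local weight condition is a circular improvement. -/
theorem isCircular_of_isCycle [Fintype V] {d : ℕ} {O U : Finset V} (hO : Indep G O)
    (hOA : Disjoint O A) (hn : ∀ u ∈ O, n u ∈ nbhd G {u} A) (hUO : U ⊆ O)
    (hU : ∀ u ∈ U, 2 ≤ (nbhd G {u} A).card ∧ n₂ u ∈ nbhd G {u} A ∧ n u ≠ n₂ u)
    (hcard : (U.card : ℝ) ≤ 4 * Real.logb 2 (Fintype.card V)) (hcyc : IsCycle n n₂ U)
    (hd : ∀ v ∈ A, (gainers G w A O n v).card < d)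
    (hloc : ∀ u ∈ U, (w (n u) ^ 2 + w (n₂ u) ^ 2) / 2 + sqWeight w (nbhd G {u} A \ {n u, n₂ u})
      < w u ^ 2 + (∑ x ∈ gainers G w A O n (n u) \ U, gain G w A n x
        + ∑ x ∈ gainers G w A O n (n₂ u) \ U, gain G w A n x) / 2) :
    ∃ X, IsCircular G w d A n n₂ X := by
  set C := U.biUnion (fun u => {n u, n₂ u}) with hC
  set Y : V → Finset V := fun v => gainers G w A O n v \ U with hY
  set X := U ∪ C.biUnion Y with hX
  have hYn : ∀ {v x}, x ∈ Y v → x ∈ O ∧ n x = v ∧ x ∉ U := fun {v x} hx =>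
    have h := Finset.mem_sdiff.1 hx
    ⟨(mem_gainers.1 h.1).1, (mem_gainers.1 h.1).2.1, h.2⟩
  have hXO : X ⊆ O := Finset.union_subset hUO
    (Finset.biUnion_subset.2 fun v _ x hx => (hYn hx).1)
  have hXU : X \ U = C.biUnion Y := by
    rw [hX, Finset.union_sdiff_left, Finset.sdiff_eq_self_iff_disjoint,
      Finset.disjoint_biUnion_left]
    intro v _
    exact Finset.sdiff_disjoint
  -- Equality needs `v ∈ C`, since `X` contains `Y v` only for vertices of the cycle; elsewhere the
  -- inclusion `hattle` suffices.
  have hatt : ∀ v ∈ C, attached G A n X U v = Y v := by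
    intro v hv
    ext x
    simp only [attached, Finset.mem_filter, hXU, Finset.mem_biUnion]
    constructor
    · rintro ⟨⟨v', -, hx⟩, -, rfl⟩
      rwa [(hYn hx).2.1]
    · intro hx
      exact ⟨⟨v, hv, hx⟩, ⟨_, hn x (hYn hx).1⟩, (hYn hx).2.1⟩
  have hattle : ∀ v, attached G A n X U v ⊆ Y v := by
    intro v x
    simp only [attached, Finset.mem_filter, hXU, Finset.mem_biUnion]
    rintro ⟨⟨v', -, hx⟩, -, rfl⟩
    rwa [(hYn hx).2.1]
  have hYdisj : ∀ v v', v ≠ v' → Disjoint (Y v) (Y v') := fun v v' hne =>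
    Finset.disjoint_left.2 fun x hx hx' => hne ((hYn hx).2.1.symm.trans (hYn hx').2.1)
  have hnC : ∀ u ∈ U, n u ∈ C ∧ n₂ u ∈ C := fun u hu =>
    ⟨Finset.mem_biUnion.2 ⟨u, hu, by simp⟩, Finset.mem_biUnion.2 ⟨u, hu, by simp⟩⟩
  have hgainY : ∀ v, ∑ x ∈ Y v, gain G w A n x
      = sqWeight w (Y v) - ∑ x ∈ Y v, sqWeight w (nbhd G {x} A \ {v}) := by
    intro v
    rw [sqWeight, ← Finset.sum_sub_distrib]
    refine Finset.sum_congr rfl fun x hx => ?_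
    rw [gain, (hYn hx).2.1]
  have hUne : U.Nonempty := by
    obtain ⟨k, a, e, -, -, rfl, -⟩ := hcyc
    exact ⟨e 0, by simp⟩
  refine ⟨X, isLocalImprovement_of_lt (hO.mono hXO) (hOA.mono_left hXO) ?_, hOA.mono_left hXO, U,
    Finset.subset_union_left, fun u hu => (hU u hu).1, hcard, hcyc, ?_, ?_, ?_⟩
  · have hsub : nbhd G X A ⊆ (C ∪ U.biUnion fun u => nbhd G {u} A \ {n u, n₂ u}) ∪
        C.biUnion fun v => (Y v).biUnion fun x => nbhd G {x} A \ {v} := by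
      rw [nbhd_eq_biUnion]
      intro x hx
      obtain ⟨u, hu, hxu⟩ := Finset.mem_biUnion.1 hx
      by_cases hxC : x ∈ C
      · exact Finset.mem_union_left _ (Finset.mem_union_left _ hxC)
      · rcases Finset.mem_union.1 hu with hu | hu
        · refine Finset.mem_union_left _ (Finset.mem_union_right _
            (Finset.mem_biUnion.2 ⟨u, hu, Finset.mem_sdiff.2 ⟨hxu, fun h => hxC ?_⟩⟩))
          exact Finset.mem_biUnion.2 ⟨u, hu, h⟩
        · obtain ⟨v, hv, huv⟩ := Finset.mem_biUnion.1 hu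
          refine Finset.mem_union_right _ (Finset.mem_biUnion.2 ⟨v, hv,
            Finset.mem_biUnion.2 ⟨u, huv, Finset.mem_sdiff.2 ⟨hxu, fun h => hxC ?_⟩⟩⟩)
          rw [Finset.mem_singleton] at h
          rwa [h]
    have h1 := (sqWeight_mono (w := w) hsub).trans (sqWeight_union_le _ _)
    have h2 := sqWeight_union_le (w := w) C (U.biUnion fun u => nbhd G {u} A \ {n u, n₂ u})
    have h3 := sqWeight_biUnion_le (w := w) U fun u => nbhd G {u} A \ {n u, n₂ u}
    have h4 := sqWeight_biUnion_le (w := w) C fun v => (Y v).biUnion fun x => nbhd G {x} A \ {v}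
    have h5 : ∑ v ∈ C, sqWeight w ((Y v).biUnion fun x => nbhd G {x} A \ {v})
        ≤ ∑ v ∈ C, ∑ x ∈ Y v, sqWeight w (nbhd G {x} A \ {v}) :=
      Finset.sum_le_sum fun v _ => sqWeight_biUnion_le _ _
    have h6 : sqWeight w X = sqWeight w U + ∑ v ∈ C, sqWeight w (Y v) := by
      unfold sqWeight
      rw [hX, Finset.sum_union, Finset.sum_biUnion]
      · exact fun v _ v' _ hne => hYdisj v v' hne
      · rw [Finset.disjoint_biUnion_right]
        intro v _
        exact Finset.disjoint_sdiff
    have h7 := Finset.sum_lt_sum_of_nonempty hUne hloc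
    -- Summing the local condition over the edges counts each cycle vertex twice, which cancels its
    -- factors 1/2 and leaves w²(N(X,A)) < w²(X).
    have h8 := hcyc.sum_eq fun v => w v ^ 2 - ∑ x ∈ Y v, gain G w A n x
    have h9 : ∑ v ∈ C, (w v ^ 2 - ∑ x ∈ Y v, gain G w A n x) = sqWeight w C
        - ∑ v ∈ C, sqWeight w (Y v) + ∑ v ∈ C, ∑ x ∈ Y v, sqWeight w (nbhd G {x} A \ {v}) := by
      rw [sqWeight, ← Finset.sum_sub_distrib, ← Finset.sum_add_distrib]
      refine Finset.sum_congr rfl fun v _ => ?_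
      rw [hgainY v]
      ring
    rw [← hC, h9] at h8
    simp only [Finset.sum_add_distrib, Finset.sum_sub_distrib, ← Finset.sum_div] at h7 h8
    have h10 : sqWeight w U = ∑ u ∈ U, w u ^ 2 := rfl
    linarith
  · intro v hv
    have h1 := Finset.card_le_card ((hattle v).trans Finset.sdiff_subset)
    have h2 := hd v hv
    omega
  · rw [← hC, Finset.biUnion_congr rfl hatt]
  · intro u hu
    rw [hatt _ (hnC u hu).1, hatt _ (hnC u hu).2]
    have h1 := hloc u hu
    have h2 : sqWeight w (Y (n u) ∪ Y (n₂ u)) = sqWeight w (Y (n u)) + sqWeight w (Y (n₂ u)) :=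
      Finset.sum_union (hYdisj _ _ (hU u hu).2.2)
    have h3 := hgainY (n u)
    have h4 := hgainY (n₂ u)
    linarith

/-- At most two edges of a cycle are incident with a given vertex. -/
theorem IsCycle.card_filter_le_two {U : Finset V} (h : IsCycle n n₂ U) (v : V) :
    (U.filter fun u => n u = v).card ≤ 2 := by
  -- Double counting for the indicator function of `v`.
  have h1 := h.sum_eq fun x => if x = v then 1 else 0
  have h2 : ∑ x ∈ U.biUnion (fun u => {n u, n₂ u}), (if x = v then (1 : ℝ) else 0) ≤ 1 := by
    rw [Finset.sum_ite_eq']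
    split_ifs <;> norm_num
  have h3 : (0 : ℝ) ≤ ∑ u ∈ U, if n₂ u = v then (1 : ℝ) else 0 :=
    Finset.sum_nonneg fun _ _ => by split_ifs <;> norm_num
  rw [Finset.sum_add_distrib, Finset.sum_boole] at h1
  have h4 : ((U.filter fun u => n u = v).card : ℝ) ≤ 2 := by linarith
  exact_mod_cast h4

/-- A cycle whose elements have small gain hardly affects the total gain at a vertex. -/
theorem IsCycle.sum_gainers_le {O U : Finset V} (h : IsCycle n n₂ U) {ε : ℝ}
    (hU : ∀ u ∈ U, gain G w A n u ≤ ε * w (n u) ^ 2) (hε : 0 ≤ ε) (v : V) :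
    ∑ x ∈ gainers G w A O n v, gain G w A n x - 2 * ε * w v ^ 2
      ≤ ∑ x ∈ gainers G w A O n v \ U, gain G w A n x := by
  rw [← Finset.sum_inter_add_sum_sdiff (gainers G w A O n v) U]
  have h1 := Finset.sum_le_card_nsmul (gainers G w A O n v ∩ U) (gain G w A n) (ε * w v ^ 2)
    (fun x hx => by
      obtain ⟨hx, hxU⟩ := Finset.mem_inter.1 hx
      have := hU x hxU
      rwa [(mem_gainers.1 hx).2.1] at this)
  have h2 : (gainers G w A O n v ∩ U).card ≤ 2 := by
    refine le_trans (Finset.card_le_card fun x hx => ?_) (h.card_filter_le_two v)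
    obtain ⟨hx, hxU⟩ := Finset.mem_inter.1 hx
    exact Finset.mem_filter.2 ⟨hxU, (mem_gainers.1 hx).2.1⟩
  rw [nsmul_eq_mul] at h1
  have h3 : ((gainers G w A O n v ∩ U).card : ℝ) ≤ 2 := by exact_mod_cast h2
  have h4 := mul_le_mul_of_nonneg_right h3 (mul_nonneg hε (sq_nonneg (w v)))
  linarith

end MWIS

/-! ### Numerical estimates and the global counting argument. -/

namespace MWIS

/-- A vertex of weight `x` whose neighborhood has total weight `s` and maximum weight `1` has
bounded `s` if it gains at most `1` and has almost no deficit. -/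
theorem le_six_of_gain_le_one {s x q ε : ℝ} (hε : ε ≤ 1 / 100)
    (hs : 1 ≤ s) (hx : (1 - ε) * s / 2 ≤ x) (hq : q ≤ s - 1) (hgain : x ^ 2 - q ≤ 1) : s ≤ 6 := by
  have h1 : 99 / 200 * s ≤ x := by nlinarith
  nlinarith

/-- Normalized estimates for a vertex with almost no gain and almost no deficit. -/
theorem near_of_gain_small {s x q m η : ℝ} (hη : 0 < η) (hη' : η ≤ 1 / 32) (hs : 1 ≤ s)
    (hx : (1 - η ^ 2 / 729) * s / 2 ≤ x) (hm1 : m ≤ 1)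
    (hq : q ≤ m * (s - 1)) (hgain : x ^ 2 - q ≤ η ^ 2 / 729) :
    1 - η ≤ x ∧ x ≤ 1 + η ∧ 1 - η ≤ m ∧ s - 1 - m ≤ η := by
  -- The errors below accumulate to `9 * r`, and the deficit parameter η²/729 becomes r²/9.
  obtain ⟨r, rfl⟩ : ∃ r, η = 9 * r := ⟨η / 9, by ring⟩
  have hr : 0 < r := by linarith
  have hr' : r ≤ 1 / 288 := by linarith
  have hεr : (9 * r) ^ 2 / 729 = r ^ 2 / 9 := by ring
  rw [hεr] at hx hgain
  have hrr : r ^ 2 ≤ r / 288 := by nlinarith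
  have hq1 : q ≤ s - 1 := hq.trans (by nlinarith)
  have hxpos : 0 ≤ (1 - r ^ 2 / 9) * s / 2 := by
    have : 0 ≤ 1 - r ^ 2 / 9 := by nlinarith
    positivity
  have hsq : ((1 - r ^ 2 / 9) * s / 2) ^ 2 ≤ x ^ 2 := pow_le_pow_left₀ hxpos hx 2
  have hb : (1 - 2 * (r ^ 2 / 9)) * s ^ 2 / 4 ≤ x ^ 2 := by
    have h1 : 0 ≤ (r ^ 2 / 9) ^ 2 * s ^ 2 := by positivity
    linarith
  have hs4 : s ≤ 4 := by
    have h9 : 9 / 10 * s ^ 2 / 4 ≤ x ^ 2 := by nlinarith [sq_nonneg s]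
    nlinarith
  -- With ε = r²/9, combining `hb`, `hgain` and `hq1` bounds the left side by ε(1 + s²/2), which is
  -- at most 9ε as s ≤ 4.
  have hsr : (s / 2 - 1) ^ 2 ≤ r ^ 2 := by
    have : s ^ 2 ≤ 16 := by nlinarith
    nlinarith [sq_nonneg r]
  obtain ⟨hlo, hhi⟩ := abs_le.1 (abs_le_of_sq_le_sq hsr hr.le)
  have hs2 : s - 1 ≤ 1 + 2 * r := by linarith
  have hx1 : 1 - 2 * r ≤ x := by
    have h1 : r ^ 2 / 9 * s ≤ r / 288 := by
      have : r ^ 2 * s ≤ r ^ 2 * 4 := mul_le_mul_of_nonneg_left hs4 (sq_nonneg r)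
      linarith
    linarith
  have hx2 : 1 - 4 * r ≤ x ^ 2 := by
    have := pow_le_pow_left₀ (by linarith) hx1 2
    linarith [sq_nonneg r]
  have hq2 : 1 - 5 * r ≤ q := by linarith
  have hm0 : 0 ≤ m := by
    by_contra h
    have := mul_nonneg (neg_nonneg.2 (not_le.1 h).le) (sub_nonneg.2 hs)
    linarith
  have hm2 : 1 - 7 * r ≤ m := by
    by_contra h
    have h1 : m * (s - 1) ≤ m * (1 + 2 * r) := mul_le_mul_of_nonneg_left hs2 hm0
    have h2 : m * (1 + 2 * r) ≤ (1 - 7 * r) * (1 + 2 * r) :=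
      mul_le_mul_of_nonneg_right (not_le.1 h).le (by linarith)
    have h3 : (1 - 7 * r) * (1 + 2 * r) = 1 - 5 * r - 14 * r ^ 2 := by ring
    have h4 : 0 < r ^ 2 := by positivity
    linarith
  refine ⟨by linarith, ?_, by linarith, by linarith⟩
  by_contra h
  have h1 := pow_le_pow_left₀ (by linarith) (not_le.1 h).le 2
  linarith [sq_nonneg r]

/-- The counting argument: vertices of `B` see few elements of `O`, up to deficits, gains and
elements of `E`, and the gain at all other vertices is small. -/
theorem sum_le_of_gain_bounds {V : Type*} [DecidableEq V] {O S B E : Finset V} {N : V → Finset V}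
    {n : V → V} {w P : V → ℝ} {D t ε η : ℝ} (hw : ∀ v, 0 < w v) (hNS : ∀ u ∈ O, N u ⊆ S)
    (hnN : ∀ u ∈ O, n u ∈ N u) (hdeg : ∀ v ∈ S, ((O.filter fun u => v ∈ N u).card : ℝ) ≤ D)
    (hP : ∀ u ∈ O, 0 ≤ P u) (hBS : B ⊆ S) (hEO : E ⊆ O)
    (hG : ∀ v ∈ S, ∑ u ∈ O with n u = v, P u ≤ w v ^ 2)
    (hGB : ∀ v ∈ S, v ∉ B → ∑ u ∈ O with n u = v, P u ≤ t * w v ^ 2)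
    (hcharge : ∀ u ∈ O, w u ≤ weight w (N u) / 2 + P u / w (n u) / 2)
    (hE : ∑ u ∈ E, w u ≤ 4 * weight w S) (hε : 0 < ε) (hη : 0 < η) (ht : t = 16 * η)
    (hD : (7 / ε + 14) / η ≤ D)
    (hB : ∀ u ∈ O, weight w (N u ∩ B) ≤ 2 / ε * max (weight w (N u) / 2 - w u) 0
      + 6 / ε * (P u / w (n u)) + 3 * (if u ∈ E then w u else 0) + η * w (n u)) :
    ∑ u ∈ O, w u ≤ (D + 2 * t) / 2 * weight w S := by
  have hcount : ∀ R ⊆ S, ∑ u ∈ O, weight w (N u ∩ R)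
      = ∑ v ∈ R, ((O.filter fun u => v ∈ N u).card : ℝ) * w v := by
    intro R _
    simp only [weight]
    rw [Finset.sum_comm' (t' := R) (s' := fun v => O.filter fun u => v ∈ N u)]
    · simp
    · intro u v
      simp only [Finset.mem_inter, Finset.mem_filter]
      tauto
  have hfib : ∀ F : V → ℝ, ∑ v ∈ S, ∑ u ∈ O with n u = v, F u = ∑ u ∈ O, F u := fun F =>
    Finset.sum_fiberwise_of_maps_to (fun u hu => hNS u hu (hnN u hu)) F
  have hratio : ∑ u ∈ O, P u / w (n u) = ∑ v ∈ S, (∑ u ∈ O with n u = v, P u) / w v := by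
    rw [← hfib]
    refine Finset.sum_congr rfl fun v _ => ?_
    rw [Finset.sum_div]
    exact Finset.sum_congr rfl fun u hu => by rw [(Finset.mem_filter.1 hu).2]
  have hdiv : ∀ v c, ∑ u ∈ O with n u = v, P u ≤ c * w v ^ 2 →
      (∑ u ∈ O with n u = v, P u) / w v ≤ c * w v := fun v c h => by
    rw [div_le_iff₀ (hw v)]
    linarith
  have hsplit : ∀ F : V → ℝ, ∑ v ∈ S, F v = ∑ v ∈ S \ B, F v + ∑ v ∈ B, F v := fun F =>
    (Finset.sum_sdiff hBS).symm
  have hratio_le : ∑ u ∈ O, P u / w (n u) ≤ t * (weight w S - weight w B) + weight w B := by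
    rw [hratio, hsplit]
    have h1 : ∑ v ∈ S \ B, (∑ u ∈ O with n u = v, P u) / w v ≤ ∑ v ∈ S \ B, t * w v :=
      Finset.sum_le_sum fun v hv => hdiv v t
        (hGB v (Finset.mem_sdiff.1 hv).1 (Finset.mem_sdiff.1 hv).2)
    have h2 : ∑ v ∈ B, (∑ u ∈ O with n u = v, P u) / w v ≤ ∑ v ∈ B, w v :=
      Finset.sum_le_sum fun v hv => by
        simpa using hdiv v 1 (by simpa using hG v (hBS hv))
    rw [← Finset.mul_sum] at h1
    have h3 := hsplit w
    unfold weight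
    rw [h3, add_sub_cancel_right]
    linarith
  have hratio_le' : ∑ u ∈ O, P u / w (n u) ≤ weight w S := by
    rw [hratio]
    exact Finset.sum_le_sum fun v hv => by simpa using hdiv v 1 (by simpa using hG v hv)
  have hdegsum : ∀ R ⊆ S, ∑ u ∈ O, weight w (N u ∩ R) ≤ D * weight w R := by
    intro R hR
    rw [hcount R hR, weight, Finset.mul_sum]
    exact Finset.sum_le_sum fun v hv => mul_le_mul_of_nonneg_right (hdeg v (hR hv)) (hw v).le
  have hNsum : ∑ u ∈ O, weight w (N u)
      ≤ D * (weight w S - weight w B) + ∑ u ∈ O, weight w (N u ∩ B) := by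
    have h1 : ∀ u ∈ O, weight w (N u) = weight w (N u ∩ (S \ B)) + weight w (N u ∩ B) := by
      intro u hu
      unfold weight
      rw [← Finset.sum_union, ← Finset.inter_union_distrib_left, Finset.sdiff_union_of_subset hBS,
        Finset.inter_eq_left.2 (hNS u hu)]
      exact Finset.disjoint_left.2 fun x hx hx' =>
        (Finset.mem_sdiff.1 (Finset.mem_inter.1 hx).2).2 (Finset.mem_inter.1 hx').2
    rw [Finset.sum_congr rfl h1, Finset.sum_add_distrib]
    have h2 := hdegsum (S \ B) Finset.sdiff_subset
    have h3 := hsplit w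
    unfold weight at *
    rw [h3, add_sub_cancel_right]
    linarith
  -- The total deficit. If it is at least half of `weight w S`, it cancels the contribution of the
  -- gains.
  set L := ∑ u ∈ O, max (weight w (N u) / 2 - w u) 0 with hL
  have hmain : ∑ u ∈ O, w u
      ≤ (∑ u ∈ O, weight w (N u)) / 2 + (∑ u ∈ O, P u / w (n u)) / 2 - L := by
    rw [hL, Finset.sum_div, Finset.sum_div, ← Finset.sum_add_distrib, ← Finset.sum_sub_distrib]
    refine Finset.sum_le_sum fun u hu => ?_
    have h1 := hcharge u hu
    have h2 : 0 ≤ P u / w (n u) := div_nonneg (hP u hu) (hw _).le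
    rcases le_total (weight w (N u) / 2 - w u) 0 with h | h
    · rw [max_eq_right h]
      linarith
    · rw [max_eq_left h]
      linarith
  have hL0 : 0 ≤ L := Finset.sum_nonneg fun u _ => le_max_right _ _
  have hWpos : 0 ≤ weight w S := Finset.sum_nonneg fun v _ => (hw v).le
  have hBpos : 0 ≤ weight w B := Finset.sum_nonneg fun v _ => (hw v).le
  have hnsum : ∑ u ∈ O, w (n u) ≤ D * weight w S := by
    refine le_trans (Finset.sum_le_sum fun u hu => ?_) (hdegsum S subset_rfl)
    rw [Finset.inter_eq_left.2 (hNS u hu)]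
    exact Finset.single_le_sum (f := w) (fun v _ => (hw v).le) (hnN u hu)
  have hBsum : ∑ u ∈ O, weight w (N u ∩ B)
      ≤ 2 / ε * L + 6 / ε * weight w S + 12 * weight w S + η * (D * weight w S) := by
    refine (Finset.sum_le_sum hB).trans ?_
    simp only [Finset.sum_add_distrib, ← Finset.mul_sum]
    have h1 : ∑ u ∈ O, (if u ∈ E then w u else 0) = ∑ u ∈ E, w u := by
      rw [← Finset.sum_filter, Finset.filter_mem_eq_inter, Finset.inter_eq_right.2 hEO]
    rw [h1, ← hL]
    have h2 : 6 / ε * ∑ u ∈ O, P u / w (n u) ≤ 6 / ε * weight w S :=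
      mul_le_mul_of_nonneg_left hratio_le' (by positivity)
    have h3 := mul_le_mul_of_nonneg_left hnsum hη.le
    linarith
  have hηD : 7 / ε + 14 ≤ D * η := (div_le_iff₀ hη).1 hD
  have hBD := hdegsum B hBS
  have htW : 0 ≤ t * weight w S := mul_nonneg (by linarith) hWpos
  have htB : 0 ≤ t * weight w B := mul_nonneg (by linarith) hBpos
  by_cases hLW : weight w S / 2 ≤ L
  · linarith
  push Not at hLW
  by_cases hBt : weight w B ≤ t * weight w S
  · linarith
  push Not at hBt
  -- Now `L` is small and `B` heavy: the loss `D * weight w B` exceeds `16 * (D * η * weight w S)`,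
  -- while the bound on `D` limits the other terms.
  have hD0 : 0 ≤ D := le_trans (by positivity) hD
  have h1 : 2 / ε * L ≤ 2 / ε * (weight w S / 2) :=
    mul_le_mul_of_nonneg_left hLW.le (by positivity)
  have h2 := mul_le_mul_of_nonneg_right hηD hWpos
  have h3 := mul_le_mul_of_nonneg_left hBt.le hD0
  have h4 : D * (t * weight w S) = 16 * (D * η * weight w S) := by rw [ht]; ring
  have h5 : (7 / ε + 14) * weight w S
      = 2 / ε * (weight w S / 2) + 6 / ε * weight w S + 14 * weight w S := by ring
  have h6 : η * (D * weight w S) = D * η * weight w S := by ring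
  have h7 : weight w B ≤ weight w S :=
    Finset.sum_le_sum_of_subset_of_nonneg hBS fun v _ _ => (hw v).le
  have h8 : 0 ≤ D * η * weight w S := by positivity
  have h9 : 2 * ∑ u ∈ O, w u ≤ D * weight w S + t * weight w S := by linarith
  linarith

end MWIS

/-! ### Near and tight vertices. -/

namespace MWIS

variable {V : Type*} {w : V → ℝ} {A : Finset V} {n n₂ : V → V}

theorem sqWeight_le_mul_weight {S : Finset V} {m : ℝ} (hw : ∀ v, 0 < w v) (h : ∀ v ∈ S, w v ≤ m) :
    sqWeight w S ≤ m * weight w S := by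
  unfold sqWeight weight
  rw [Finset.mul_sum]
  refine Finset.sum_le_sum fun v hv => ?_
  rw [sq]
  exact mul_le_mul_of_nonneg_right (h v hv) (hw v).le

theorem ClawFree.card_lt {G : SimpleGraph V} {d : ℕ} (hG : ClawFree G d) {v : V} {T : Finset V}
    (hT : IsClawAt G v T) : T.card < d := by
  by_contra h
  obtain ⟨T', hT', hc⟩ := Finset.exists_subset_card_eq (not_lt.1 h)
  exact hG v T' ⟨fun t ht => hT.1 t (hT' ht), hT.2.mono hT'⟩ hc

variable [DecidableEq V] {G : SimpleGraph V} [DecidableRel G.Adj]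

theorem weight_sdiff_singleton {S : Finset V} {v : V} (hv : v ∈ S) :
    weight w (S \ {v}) = weight w S - w v := by
  unfold weight
  rw [← Finset.sum_sdiff (Finset.singleton_subset_iff.2 hv), Finset.sum_singleton]
  ring

theorem weight_sdiff_pair {S : Finset V} {x y : V} (hx : x ∈ S) (hy : y ∈ S \ {x}) :
    weight w (S \ {x, y}) = weight w S - w x - w y := by
  have h : S \ {x, y} = (S \ {x}) \ {y} := by
    ext z
    simp only [Finset.mem_sdiff, Finset.mem_insert, Finset.mem_singleton]
    tauto
  rw [h, weight_sdiff_singleton hy, weight_sdiff_singleton hx]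

/-- The gain of `u` dominates its charge to its heaviest neighbor. -/
theorem two_mul_charge_mul_le_gain (hw : ∀ v, 0 < w v) {u : V} (hn : n u ∈ nbhd G {u} A)
    (hmax : ∀ v ∈ nbhd G {u} A, w v ≤ w (n u)) :
    2 * (w u - weight w (nbhd G {u} A) / 2) * w (n u) ≤ gain G w A n u := by
  have h1 := sqWeight_le_mul_weight (S := nbhd G {u} A \ {n u}) hw
    fun v hv => hmax v (Finset.mem_sdiff.1 hv).1
  rw [weight_sdiff_singleton hn] at h1
  unfold gain
  nlinarith [sq_nonneg (w u - w (n u))]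

/-- The vertex `u` has almost the same weight as its two heaviest neighbors in `A`, its other
neighbors in `A` are light, and its gain is small. -/
structure IsNear (G : SimpleGraph V) [DecidableRel G.Adj] (w : V → ℝ) (A : Finset V)
    (n n₂ : V → V) (η : ℝ) (u : V) : Prop where
  two_le_card : 2 ≤ (nbhd G {u} A).card
  le_weight : (1 - η) * w (n u) ≤ w u
  weight_le : w u ≤ (1 + η) * w (n u)
  le_second : (1 - η) * w (n u) ≤ w (n₂ u)
  rest_le : weight w (nbhd G {u} A \ {n u, n₂ u}) ≤ η * w (n u)
  gain_le : gain G w A n u ≤ η ^ 2 / 729 * w (n u) ^ 2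

/-- Every vertex with small deficit either has a substantial gain or is near. -/
theorem gain_or_isNear (hw : ∀ v, 0 < w v) {η : ℝ} (hη : 0 < η) (hη' : η ≤ 1 / 32) {u : V}
    (hn : n u ∈ nbhd G {u} A) (hmax : ∀ v ∈ nbhd G {u} A, w v ≤ w (n u))
    (hn₂ : 2 ≤ (nbhd G {u} A).card → n₂ u ∈ nbhd G {u} A \ {n u} ∧
      ∀ v ∈ nbhd G {u} A \ {n u}, w v ≤ w (n₂ u))
    (hgain : gain G w A n u ≤ w (n u) ^ 2)
    (hdef : (1 - η ^ 2 / 729) * weight w (nbhd G {u} A) / 2 ≤ w u) :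
    (η ^ 2 / 729 * w (n u) ^ 2 ≤ gain G w A n u ∧
      weight w (nbhd G {u} A) ≤ 6 * w (n u)) ∨ IsNear G w A n n₂ η u := by
  set a := w (n u) with ha
  have ha0 : 0 < a := hw _
  set s := weight w (nbhd G {u} A) with hs
  set q := sqWeight w (nbhd G {u} A \ {n u}) with hq
  have hgq : gain G w A n u = w u ^ 2 - q := rfl
  have has : a ≤ s := Finset.single_le_sum (f := w) (fun v _ => (hw v).le) hn
  have hsa : 1 ≤ s / a := (one_le_div ha0).2 has
  have hdef' : (1 - η ^ 2 / 729) * (s / a) / 2 ≤ w u / a := by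
    rw [← mul_div_assoc, div_right_comm]
    exact div_le_div_of_nonneg_right hdef ha0.le
  have hgain' : ∀ c, gain G w A n u ≤ c * a ^ 2 → (w u / a) ^ 2 - q / a ^ 2 ≤ c := by
    intro c hc
    rw [div_pow, ← sub_div, div_le_iff₀ (by positivity), ← hgq]
    exact hc
  have hq_le : ∀ m, q ≤ m * (s - a) → q / a ^ 2 ≤ m / a * (s / a - 1) := by
    intro m hm
    rw [div_sub_one ha0.ne', div_mul_div_comm, ← sq]
    exact div_le_div_of_nonneg_right hm (by positivity)
  rcases le_total (η ^ 2 / 729 * a ^ 2) (gain G w A n u) with hh | hh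
  · left
    refine ⟨hh, ?_⟩
    have h1 := sqWeight_le_mul_weight (S := nbhd G {u} A \ {n u}) hw
      fun v hv => hmax v (Finset.mem_sdiff.1 hv).1
    rw [weight_sdiff_singleton hn] at h1
    have h2 := le_six_of_gain_le_one (by nlinarith) hsa hdef'
      (by simpa [ha0.ne'] using hq_le a h1) (hgain' 1 (by simpa using hgain))
    exact (div_le_iff₀ ha0).1 h2
  · right
    by_cases hcard : 2 ≤ (nbhd G {u} A).card
    · obtain ⟨hmem, hmax₂⟩ := hn₂ hcard
      have h1 := sqWeight_le_mul_weight (S := nbhd G {u} A \ {n u}) hw hmax₂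
      rw [weight_sdiff_singleton hn] at h1
      obtain ⟨h2, h3, h4, h5⟩ := near_of_gain_small hη hη' hsa hdef'
        ((div_le_one ha0).2 (hmax _ (Finset.mem_sdiff.1 hmem).1)) (hq_le _ h1) (hgain' _ hh)
      refine ⟨hcard, (le_div_iff₀ ha0).1 h2, (div_le_iff₀ ha0).1 h3, (le_div_iff₀ ha0).1 h4, ?_, hh⟩
      rw [weight_sdiff_pair hn hmem]
      rw [div_sub_one ha0.ne', ← sub_div, div_le_iff₀ ha0] at h5
      exact h5
    -- A single neighbor would amount to a second heaviest one of weight `m = 0`, contradicting `1 -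
    -- η ≤ m`.
    · exfalso
      have h1 : nbhd G {u} A \ {n u} = ∅ := by
        rw [← Finset.card_eq_zero, Finset.card_sdiff_of_subset (Finset.singleton_subset_iff.2 hn),
          Finset.card_singleton]
        omega
      have h2 : q = 0 := by rw [hq, h1]; rfl
      obtain ⟨-, -, h4, -⟩ := near_of_gain_small hη hη' hsa hdef' (zero_le_one)
        (by simp [h2] : q / a ^ 2 ≤ 0 * (s / a - 1)) (hgain' _ hh)
      linarith

/-- The total gain at `v` is at least the fraction `t` of the maximum `w²(v)`. -/
def IsTight (G : SimpleGraph V) [DecidableRel G.Adj] (w : V → ℝ) (A O : Finset V) (n : V → V)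
    (t : ℝ) (v : V) : Prop :=
  t * w v ^ 2 ≤ ∑ x ∈ gainers G w A O n v, gain G w A n x

/-- The local weight condition holds at the elements of a cycle of near vertices one of whose two
heaviest neighbors is tight. -/
theorem IsNear.local_condition (hw : ∀ v, 0 < w v) {η : ℝ} (hη : 0 < η) (hη' : η ≤ 1 / 32)
    {O U : Finset V} (hcyc : IsCycle n n₂ U) (hU : ∀ u ∈ U, IsNear G w A n n₂ η u) {u : V}
    (hu : u ∈ U) (hmax : ∀ v ∈ nbhd G {u} A, w v ≤ w (n u)) (hmem : n₂ u ∈ nbhd G {u} A)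
    (htight : IsTight G w A O n (16 * η) (n u) ∨ IsTight G w A O n (16 * η) (n₂ u)) :
    (w (n u) ^ 2 + w (n₂ u) ^ 2) / 2 + sqWeight w (nbhd G {u} A \ {n u, n₂ u})
      < w u ^ 2 + (∑ x ∈ gainers G w A O n (n u) \ U, gain G w A n x
        + ∑ x ∈ gainers G w A O n (n₂ u) \ U, gain G w A n x) / 2 := by
  have h := hU u hu
  set a := w (n u) with ha
  have ha0 : 0 < a := hw _
  have hnonneg : ∀ v, 0 ≤ ∑ x ∈ gainers G w A O n v \ U, gain G w A n x := fun v =>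
    Finset.sum_nonneg fun x hx => (mem_gainers.1 (Finset.mem_sdiff.1 hx).1).2.2.le
  have hsq : ((1 - η) * a) ^ 2 ≤ w u ^ 2 :=
    pow_le_pow_left₀ (mul_nonneg (by linarith) ha0.le) h.le_weight 2
  -- Removing `U` costs at most two gains of η²/729 · w(v)² each, so of the 16η at a tight vertex at
  -- least 14η remains.
  have hlow : ∀ v, (1 - η) * a ≤ w v → IsTight G w A O n (16 * η) v →
      14 * η * ((1 - η) * a) ^ 2 ≤ ∑ x ∈ gainers G w A O n v \ U, gain G w A n x := by
    intro v hv ht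
    have h1 := hcyc.sum_gainers_le (O := O) (fun u hu => (hU u hu).gain_le) (by positivity) v
    have h2 : ((1 - η) * a) ^ 2 ≤ w v ^ 2 :=
      pow_le_pow_left₀ (mul_nonneg (by linarith) ha0.le) hv 2
    unfold IsTight at ht
    have h3 : η ^ 2 / 729 ≤ η := by nlinarith
    have h4 : η ^ 2 / 729 * w v ^ 2 ≤ η * w v ^ 2 := mul_le_mul_of_nonneg_right h3 (sq_nonneg _)
    have h5 := mul_le_mul_of_nonneg_left h2 (by linarith : 0 ≤ 14 * η)
    linarith
  have hsum : 14 * η * ((1 - η) * a) ^ 2 ≤ ∑ x ∈ gainers G w A O n (n u) \ U, gain G w A n x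
        + ∑ x ∈ gainers G w A O n (n₂ u) \ U, gain G w A n x := by
    rcases htight with ht | ht
    · have := hlow _ (by nlinarith) ht
      linarith [hnonneg (n₂ u)]
    · have := hlow _ h.le_second ht
      linarith [hnonneg (n u)]
  have hrest : sqWeight w (nbhd G {u} A \ {n u, n₂ u}) ≤ a * (η * a) :=
    (sqWeight_le_mul_weight hw fun v hv => hmax v (Finset.mem_sdiff.1 hv).1).trans
      (mul_le_mul_of_nonneg_left h.rest_le ha0.le)
  have hsecond : w (n₂ u) ^ 2 ≤ a ^ 2 := pow_le_pow_left₀ (hw _).le (hmax _ hmem) 2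
  have hnum : 1 + η < (1 - η) ^ 2 + 7 * η * (1 - η) ^ 2 := by
    have : 0 < η * (4 - 13 * η + 7 * η ^ 2) := mul_pos hη (by nlinarith)
    linarith
  have := mul_lt_mul_of_pos_right hnum (by positivity : 0 < a ^ 2)
  linarith

/-- The near vertices with a tight heaviest or second heaviest neighbor have small total weight. -/
theorem sum_near_le [Fintype V] (hw : ∀ v, 0 < w v) {η : ℝ} (hη : 0 < η) (hη' : η ≤ 1 / 32) {d : ℕ}
    {O S E : Finset V} (hO : Indep G O) (hOA : Disjoint O A)
    (hn : ∀ u ∈ O, n u ∈ nbhd G {u} A ∧ ∀ v ∈ nbhd G {u} A, w v ≤ w (n u))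
    (hn₂ : ∀ u ∈ O, 2 ≤ (nbhd G {u} A).card → n₂ u ∈ nbhd G {u} A \ {n u})
    (hd : ∀ v ∈ A, (gainers G w A O n v).card < d) (hS : ∀ u ∈ O, nbhd G {u} A ⊆ S)
    (hEO : E ⊆ O)
    (hE : ∀ u ∈ E, IsNear G w A n n₂ η u ∧
      (IsTight G w A O n (16 * η) (n u) ∨ IsTight G w A O n (16 * η) (n₂ u)))
    (hcirc : ∀ X, ¬ IsCircular G w d A n n₂ X) : ∑ u ∈ E, w u ≤ 4 * weight w S := by
  have hE₂ : ∀ u ∈ E, n₂ u ∈ nbhd G {u} A ∧ n u ≠ n₂ u := fun u hu => by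
    have := Finset.mem_sdiff.1 (hn₂ u (hEO hu) (hE u hu).1.two_le_card)
    exact ⟨this.1, fun h => this.2 (by simp [h])⟩
  have hfilter : E.filter (fun u => n u ∈ S ∧ n₂ u ∈ S) = E :=
    Finset.filter_true_of_mem fun u hu =>
      ⟨hS u (hEO hu) (hn u (hEO hu)).1, hS u (hEO hu) (hE₂ u hu).1⟩
  rw [← hfilter]
  -- Cycles of length up to 2(⌊log₂|V|⌋ + 1) are excluded. This is at most 4 log₂|V|, since a cycle
  -- forces |V| ≥ 2.
  refine sum_le_of_forall_not_isCycle (k := Nat.log 2 (Fintype.card V) + 1) ?_ ?_ S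
    (fun v _ => (hw v).le)
    (lt_of_le_of_lt (Finset.card_le_univ S) (Nat.lt_pow_succ_log_self one_lt_two _))
  · intro u hu
    have h1 := (hE u hu).1
    have h2 := hw (n u)
    refine ⟨(hE₂ u hu).2, ?_, ?_⟩
    · nlinarith [h1.weight_le]
    · nlinarith [h1.weight_le, h1.le_second]
  · intro U hUE hcyc hcard
    have hV : 2 ≤ Fintype.card V := by
      obtain ⟨k, a, e, ha, -⟩ := hcyc
      have := Fintype.card_le_of_injective a ha
      rw [Fintype.card_fin] at this
      omega
    have hlog1 : 1 ≤ Nat.log 2 (Fintype.card V) := Nat.log_pos one_lt_two hV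
    have hlog := Real.natLog_le_logb (Fintype.card V) 2
    have hcard' : (U.card : ℝ) ≤ 4 * Real.logb 2 (Fintype.card V) := by
      have h1 : (U.card : ℝ) ≤ 4 * (Nat.log 2 (Fintype.card V) : ℕ) := by
        exact_mod_cast (by omega : U.card ≤ 4 * Nat.log 2 (Fintype.card V))
      rw [Nat.cast_ofNat] at hlog
      linarith
    obtain ⟨X, hX⟩ := isCircular_of_isCycle (w := w) hO hOA (fun u hu => (hn u hu).1)
      (hUE.trans hEO) (fun u hu => ⟨(hE u (hUE hu)).1.two_le_card, hE₂ u (hUE hu)⟩) hcard' hcyc hd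
      (fun u hu => IsNear.local_condition hw hη hη' hcyc (fun u hu => (hE u (hUE hu)).1) hu
        (hn u (hEO (hUE hu))).2 (hE₂ u (hUE hu)).1 (hE u (hUE hu)).2)
    exact hcirc X hX

/-! ### Assembling the bound. -/

/-- The approximation guarantee, for the parts of both sets outside of their intersection. -/
theorem weight_sdiff_le [Fintype V] (hw : ∀ v, 0 < w v) {η : ℝ} (hη : 0 < η) (hη' : η ≤ 1 / 32)
    {d : ℕ} (hd : (7 / (η ^ 2 / 729) + 14) / η ≤ (d : ℝ) - 1) (hG : ClawFree G d) {I : Finset V}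
    (hI : Indep G I) (hn : IsHeaviestMap G w A n) (hn₂ : IsSecondHeaviestMap G w A n n₂)
    (hopt : IsLocallyOptimal G w d A n n₂) :
    weight w (I \ A) ≤ ((d : ℝ) - 1 + 2 * (16 * η)) / 2 * weight w (A \ I) := by
  classical
  set O := I \ A with hOdef
  have hO : Indep G O := hI.mono Finset.sdiff_subset
  have hOA : Disjoint O A := Finset.sdiff_disjoint
  have hOn : ∀ u ∈ O, u ∉ A := fun u hu => Finset.disjoint_left.1 hOA hu
  have hclaw : ∀ X, ¬ IsClawShaped G w A X := fun X => (hopt X).1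
  have hmax : ∀ u ∈ O, n u ∈ nbhd G {u} A ∧ ∀ v ∈ nbhd G {u} A, w v ≤ w (n u) := fun u hu =>
    hn u (hOn u hu) (nbhd_nonempty_of_not_isClawShaped hclaw (hw u) (hOn u hu))
  have hmax₂ := fun u hu => hn₂ u (hOn u hu)
  have hNS : ∀ u ∈ O, nbhd G {u} A ⊆ A \ I := fun u hu v hv => by
    obtain ⟨hvA, hadj⟩ := (mem_nbhd_singleton (hOn u hu)).1 hv
    exact Finset.mem_sdiff.2 ⟨hvA, fun hvI => hI u (Finset.mem_sdiff.1 hu).1 v hvI hadj⟩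
  -- The neighbors of `v` in the independent set `O` are talons of a claw, so there are fewer than
  -- `d` of them.
  have hclawAt : ∀ v, IsClawAt G v (O.filter fun u => v ∈ nbhd G {u} A) := fun v =>
    ⟨fun u hu => by
      obtain ⟨hu, hv⟩ := Finset.mem_filter.1 hu
      exact ((mem_nbhd_singleton (hOn u hu)).1 hv).2.symm, hO.mono (Finset.filter_subset _ _)⟩
  have hdeg := fun v => hG.card_lt (hclawAt v)
  have hgainers : ∀ v, (gainers G w A O n v) ⊆ O.filter fun u => v ∈ nbhd G {u} A := by
    intro v u hu
    obtain ⟨huO, rfl, -⟩ := mem_gainers.1 hu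
    exact Finset.mem_filter.2 ⟨huO, (hmax u huO).1⟩
  have hsum : ∀ v, ∑ u ∈ O with n u = v, max (gain G w A n u) 0
      = ∑ u ∈ gainers G w A O n v, gain G w A n u := by
    intro v
    have h1 : gainers G w A O n v
        = (O.filter fun u => n u = v).filter fun u => 0 < gain G w A n u := by
      ext x
      simp only [mem_gainers, Finset.mem_filter, and_assoc]
    rw [h1, Finset.sum_filter (p := fun u => 0 < gain G w A n u)]
    refine Finset.sum_congr rfl fun u _ => ?_
    split_ifs with h
    · exact max_eq_left h.le
    · exact max_eq_right (not_lt.1 h)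
  have hgainle : ∀ u ∈ O, gain G w A n u ≤ w (n u) ^ 2 := fun u hu => by
    have := sum_gain_le (T := {u}) hclaw (hO.mono (Finset.singleton_subset_iff.2 hu))
      (hOA.mono_left (Finset.singleton_subset_iff.2 hu))
      (Finset.mem_sdiff.1 (hNS u hu (hmax u hu).1)).1
      (fun x hx => by
        rw [Finset.mem_singleton] at hx
        subst hx
        exact ⟨rfl, (hmax x hu).1⟩)
    simpa using this
  set B := (A \ I).filter fun v => IsTight G w A O n (16 * η) v with hBdef
  set E := O.filter fun u => IsNear G w A n n₂ η u ∧
      (IsTight G w A O n (16 * η) (n u) ∨ IsTight G w A O n (16 * η) (n₂ u)) with hEdef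
  have hε : 0 < η ^ 2 / 729 := by positivity
  refine sum_le_of_gain_bounds (O := O) (S := A \ I) (B := B) (E := E)
    (N := fun u => nbhd G {u} A) (n := n) (P := fun u => max (gain G w A n u) 0)
    (t := 16 * η) (ε := η ^ 2 / 729) hw hNS (fun u hu => (hmax u hu).1) ?_
    (fun _ _ => le_max_right _ _) (Finset.filter_subset _ _) (Finset.filter_subset _ _) ?_ ?_ ?_ ?_
    hε hη rfl hd ?_
  · intro v _
    have : ((O.filter fun u => v ∈ nbhd G {u} A).card : ℝ) + 1 ≤ d := by exact_mod_cast hdeg v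
    linarith
  · intro v hv
    rw [hsum]
    have hsub := (hgainers v).trans (Finset.filter_subset _ _)
    refine sum_gain_le hclaw (hO.mono hsub) (hOA.mono_left hsub) (Finset.mem_sdiff.1 hv).1 ?_
    intro u hu
    exact ⟨(mem_gainers.1 hu).2.1, (Finset.mem_filter.1 (hgainers v hu)).2⟩
  · intro v hv hvB
    rw [hsum]
    exact (not_le.1 fun h => hvB (Finset.mem_filter.2 ⟨hv, h⟩)).le
  · intro u hu
    have h1 := two_mul_charge_mul_le_gain hw (hmax u hu).1 (hmax u hu).2
    have h2 := (le_div_iff₀ (hw (n u))).2 (h1.trans (le_max_left _ 0))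
    linarith
  · refine sum_near_le hw hη hη' hO hOA hmax (fun u hu h => (hmax₂ u hu h).1) ?_ hNS
      (Finset.filter_subset _ _) (fun u hu => (Finset.mem_filter.1 hu).2) fun X => (hopt X).2
    exact fun v _ => (Finset.card_le_card (hgainers v)).trans_lt (hdeg v)
  · intro u hu
    have ha := hw (n u)
    set a := w (n u) with hadef
    set s := weight w (nbhd G {u} A) with hs
    have hs0 : 0 ≤ s := Finset.sum_nonneg fun v _ => (hw v).le
    have hBs : weight w (nbhd G {u} A ∩ B) ≤ s :=
      Finset.sum_le_sum_of_subset_of_nonneg Finset.inter_subset_left fun v _ _ => (hw v).le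
    have h1 : 0 ≤ 2 / (η ^ 2 / 729) * max (s / 2 - w u) 0 :=
      mul_nonneg (by positivity) (le_max_right _ _)
    have h2 : 0 ≤ 6 / (η ^ 2 / 729) * (max (gain G w A n u) 0 / a) :=
      mul_nonneg (by positivity) (div_nonneg (le_max_right _ _) ha.le)
    have h3 : 0 ≤ 3 * (if u ∈ E then w u else 0) := by
      split_ifs
      · linarith [hw u]
      · simp
    have h4 : 0 ≤ η * a := by positivity
    by_cases hdef : (1 - η ^ 2 / 729) * s / 2 ≤ w u
    · rcases gain_or_isNear hw hη hη' (hmax u hu).1 (hmax u hu).2 (hmax₂ u hu) (hgainle u hu) hdef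
        with ⟨h5, h6⟩ | hnear
      · have h7 : η ^ 2 / 729 * a ≤ max (gain G w A n u) 0 / a := by
          rw [le_div_iff₀ ha]
          refine le_trans ?_ (le_max_left _ _)
          linarith
        have h8 := mul_le_mul_of_nonneg_left h7 (by positivity : 0 ≤ 6 / (η ^ 2 / 729))
        have h9 : 6 / (η ^ 2 / 729) * (η ^ 2 / 729 * a) = 6 * a := by field_simp
        linarith
      · have hmem := (hmax₂ u hu hnear.two_le_card).1
        by_cases htight : IsTight G w A O n (16 * η) (n u) ∨ IsTight G w A O n (16 * η) (n₂ u)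
        · rw [if_pos (Finset.mem_filter.2 ⟨hu, hnear, htight⟩)]
          have h5 := hnear.rest_le
          rw [weight_sdiff_pair (hmax u hu).1 hmem] at h5
          have h6 := (hmax u hu).2 _ (Finset.mem_sdiff.1 hmem).1
          have h7 := hnear.le_weight
          have h8 := mul_le_mul_of_nonneg_right hη' ha.le
          linarith
        · have hsub : nbhd G {u} A ∩ B ⊆ nbhd G {u} A \ {n u, n₂ u} := by
            intro v hv
            obtain ⟨hvN, hvB⟩ := Finset.mem_inter.1 hv
            refine Finset.mem_sdiff.2 ⟨hvN, fun h => htight ?_⟩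
            have hvt := (Finset.mem_filter.1 hvB).2
            rcases Finset.mem_insert.1 h with rfl | h
            · exact Or.inl hvt
            · rw [Finset.mem_singleton] at h
              exact Or.inr (h ▸ hvt)
          have h5 : weight w (nbhd G {u} A ∩ B) ≤ weight w (nbhd G {u} A \ {n u, n₂ u}) :=
            Finset.sum_le_sum_of_subset_of_nonneg hsub fun v _ _ => (hw v).le
          linarith [hnear.rest_le]
    · have h5 : η ^ 2 / 729 * s / 2 ≤ max (s / 2 - w u) 0 := by
        refine le_trans ?_ (le_max_left _ _)
        linarith
      have h6 := mul_le_mul_of_nonneg_left h5 (by positivity : 0 ≤ 2 / (η ^ 2 / 729))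
      have h7 : 2 / (η ^ 2 / 729) * (η ^ 2 / 729 * s / 2) = s := by field_simp
      linarith

/-- Every run of LogImp maintains an independent set. -/
theorem indep_of_reflTransGen [Fintype V] {d : ℕ} {m m₂ : Finset V → V → V}
    (h : Relation.ReflTransGen (LogImpStep G w d m m₂) ∅ A) : Indep G A := by
  induction h with
  | refl => exact fun x hx => absurd hx (Finset.notMem_empty x)
  | @tail B _ _ hstep ih =>
    obtain ⟨X, hX, rfl⟩ := hstep
    have hXi : Indep G X := hX.elim (fun h => h.1.1) fun h => h.1.1
    have hcross : ∀ x ∈ X, ∀ y ∈ B \ nbhd G X B, ¬ G.Adj x y := fun x hx y hy hadj =>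
      (Finset.mem_sdiff.1 hy).2 (mem_nbhd.2 ⟨(Finset.mem_sdiff.1 hy).1, x, hx, Or.inl hadj⟩)
    intro x hx y hy
    rcases Finset.mem_union.1 hx with hx | hx <;> rcases Finset.mem_union.1 hy with hy | hy
    · exact ih x (Finset.mem_sdiff.1 hx).1 y (Finset.mem_sdiff.1 hy).1
    · exact fun hadj => hcross y hy x hx hadj.symm
    · exact hcross x hx y hy
    · exact hXi x hx y hy

end MWIS

theorem theorem2 (δ : ℝ) (hδ : 0 < δ) :
    ∃ dδ : ℕ, ∀ d : ℕ, dδ ≤ d →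
      ∀ (V : Type*) [Fintype V] [DecidableEq V] (G : SimpleGraph V) [DecidableRel G.Adj]
        (w : V → ℝ) (Aopt : Finset V),
        (∀ v, 0 < w v) → MWIS.ClawFree G d → MWIS.IsOptimum G w Aopt →
        (∀ (A : Finset V) (n n₂ : V → V), MWIS.Indep G A →
          MWIS.IsHeaviestMap G w A n → MWIS.IsSecondHeaviestMap G w A n n₂ →
          MWIS.IsLocallyOptimal G w d A n n₂ →
          MWIS.weight w Aopt ≤ ((d : ℝ) - 1 + δ) / 2 * MWIS.weight w A) ∧
        (∀ (n n₂ : Finset V → V → V) (A : Finset V), MWIS.IsMapChoice G w n n₂ →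
          MWIS.LogImpReturns G w d n n₂ A →
          MWIS.weight w Aopt ≤ ((d : ℝ) - 1 + δ) / 2 * MWIS.weight w A) := by
  set η := min δ 1 / 32 with hηdef
  have hη : 0 < η := by positivity
  have hη' : η ≤ 1 / 32 := div_le_div_of_nonneg_right (min_le_right _ _) (by norm_num)
  have hηδ : 32 * η ≤ δ := by
    have := min_le_left δ 1
    linarith
  obtain ⟨k, hk⟩ := exists_nat_ge ((7 / (η ^ 2 / 729) + 14) / η)
  -- Besides the bound on `d - 1`, this gives `d ≥ 3`, so the ratio is at least 1 and the common
  -- part of `Aopt` and `A` can be added to both sides.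
  refine ⟨k + 3, fun d hd V _ _ G _ w Aopt hw hG hopt => ?_⟩
  have hkd : (k : ℝ) + 3 ≤ d := by exact_mod_cast hd
  have hk0 : (0 : ℝ) ≤ k := Nat.cast_nonneg k
  have main : ∀ (A : Finset V) (n n₂ : V → V),
      MWIS.IsHeaviestMap G w A n → MWIS.IsSecondHeaviestMap G w A n n₂ →
      MWIS.IsLocallyOptimal G w d A n n₂ →
      MWIS.weight w Aopt ≤ ((d : ℝ) - 1 + δ) / 2 * MWIS.weight w A := by
    intro A n n₂ hn hn₂ hloc
    have h1 := MWIS.weight_sdiff_le hw hη hη' (by linarith) hG hopt.1 hn hn₂ hloc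
    have h2 : MWIS.weight w (Aopt ∩ A) + MWIS.weight w (Aopt \ A) = MWIS.weight w Aopt :=
      Finset.sum_inter_add_sum_sdiff Aopt A w
    have h3 : MWIS.weight w (A ∩ Aopt) + MWIS.weight w (A \ Aopt) = MWIS.weight w A :=
      Finset.sum_inter_add_sum_sdiff A Aopt w
    rw [Finset.inter_comm] at h3
    have h4 : 0 ≤ MWIS.weight w (Aopt ∩ A) := Finset.sum_nonneg fun v _ => (hw v).le
    have h5 : 0 ≤ MWIS.weight w (A \ Aopt) := Finset.sum_nonneg fun v _ => (hw v).le
    have h6 : 1 * MWIS.weight w (Aopt ∩ A) ≤ ((d : ℝ) - 1 + δ) / 2 * MWIS.weight w (Aopt ∩ A) :=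
      mul_le_mul_of_nonneg_right (by linarith) h4
    have h7 : ((d : ℝ) - 1 + 2 * (16 * η)) / 2 * MWIS.weight w (A \ Aopt)
        ≤ ((d : ℝ) - 1 + δ) / 2 * MWIS.weight w (A \ Aopt) :=
      mul_le_mul_of_nonneg_right (by linarith) h5
    rw [← h2, ← h3, mul_add]
    linarith
  refine ⟨fun A n n₂ _ => main A n n₂, fun n n₂ A hmaps hret => ?_⟩
  obtain ⟨hn, hn₂⟩ := hmaps A (MWIS.indep_of_reflTransGen hret.1)
  exact main A (n A) (n₂ A) hn hn₂ fun X =>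
    ⟨fun h => hret.2 _ ⟨X, Or.inl h, rfl⟩, fun h => hret.2 _ ⟨X, Or.inr h, rfl⟩⟩
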